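/- A geodesic in a metric space $(X,d)$ is a map $c:[a,b]\to X$ ($a\le b$) with $d(c(s),c(t))=|s-t|$ for all $s,t\in[a,b]$. A CAT(0) space is a metric space in which any two points are joined by a geodesic and such that for all $z\in X$, all geodesics $c:[a,b]\to X$ and all $t\in[0,1]$, $$d^2(z,c((1-t)a+tb))\le (1-t)d^2(z,c(a))+t\,d^2(z,c(b))-t(1-t)d^2(c(a),c(b)).$$ In such a space, $(1-t)x+ty$ ($t\in[0,1]$) denotes the point $c(t\,d(x,y))$, where $c:[0,d(x,y)]\to X$ is the unique geodesic from $x$ to $y$. Let $X$ be a complete CAT(0) space and let $f:X\to(-\infty,\infty]$ be proper (not identically $\infty$), convex (that is, $f((1-t)x+ty)\le(1-t)f(x)+tf(y)$ for all $x,y\in X$, $t\in[0,1]$, with $0\cdot\infty=0$) and lower semicontinuous. Let $\mathrm{Argmin}(f)=\{x\in X: f(x)=\inf_{y\in X}f(y)\}$. Then: 1. For every $\gamma>0$ and $x\in X$, the function $y\mapsto f(y)+\frac1{2\gamma}d^2(x,y)$ has exactly one minimizer, denoted by $J_\gamma(x)$; so the Moreau–Yosida resolvent $J_\gamma:X\to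 X$ is well defined. 2. For every sequence $(\gamma_n)_{n\in\mathbb N}$ of positive real numbers, the family $(J_{\gamma_n})$ is jointly firmly nonexpansive with respect to $(\gamma_n)$: for all $n,m\in\mathbb N$, all $x,y\in X$ and all $\alpha,\beta\in[0,1]$ with $(1-\alpha)\gamma_n=(1-\beta)\gamma_m$, $$d(J_{\gamma_n}x,J_{\gamma_m}y)\le d\big((1-\alpha)x+\alpha J_{\gamma_n}x,\,(1-\beta)y+\beta J_{\gamma_m}y\big).$$ 3. If $\mathrm{Argmin}(f)\neq\emptyset$ and $(\gamma_n)_{n\in\mathbb N}$ is a sequence of positive real numbers with $\sum_{n=0}^\infty\gamma_n^2=\infty$, then for every $x\in X$ the sequence defined by $x_0:=x$, $x_{n+1}:=J_{\gamma_n}x_n$ $\Delta$-converges to a minimizer of $f$. That is, $(x_n)$ is bounded and there is $p\in\mathrm{Argmin}(f)$ such that for every subsequence $(u_n)$ of $(x_n)$, $p$ is the unique asymptotic center of $(u_n)$, i.e. the unique point $y\in X$ at which $\limsup_{n\to\infty}d(y,u_n)$ equals $\inf_{z\in X}\limsup_{n\to\infty}d(z,u_n)$. -/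

import Mathlib

open Filter Topology

/-- `c` restricted to `[a, b]` (with `a ≤ b`) is a geodesic: an isometric embedding of `[a, b]`.
Values of `c` outside `[a, b]` are irrelevant. -/
def IsGeodesic {X : Type*} [MetricSpace X] (c : ℝ → X) (a b : ℝ) : Prop :=
  a ≤ b ∧ ∀ s ∈ Set.Icc a b, ∀ t ∈ Set.Icc a b, dist (c s) (c t) = |s - t|

/-- A geodesic space: any two points are joined by a geodesic. -/
class GeodesicSpace (X : Type*) [MetricSpace X] : Prop where
  exists_geodesic : ∀ x y : X, ∃ (c : ℝ → X) (a b : ℝ), IsGeodesic c a b ∧ c a = x ∧ c b = y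

/-- A CAT(0) space: a geodesic space in which the squared distance to any point satisfies the
CAT(0) inequality along every geodesic. -/
class CAT0Space (X : Type*) [MetricSpace X] : Prop extends GeodesicSpace X where
  cat0_ineq : ∀ (z : X) (c : ℝ → X) (a b : ℝ), IsGeodesic c a b → ∀ t ∈ Set.Icc (0 : ℝ) 1,
    dist z (c ((1 - t) * a + t * b)) ^ 2 ≤
      (1 - t) * dist z (c a) ^ 2 + t * dist z (c b) ^ 2 - t * (1 - t) * dist (c a) (c b) ^ 2

theorem GeodesicSpace.exists_normalized {X : Type*} [MetricSpace X] [GeodesicSpace X] (x y : X) :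
    ∃ c : ℝ → X, IsGeodesic c 0 (dist x y) ∧ c 0 = x ∧ c (dist x y) = y := by
  obtain ⟨c, a, b, ⟨hab, hc⟩, rfl, rfl⟩ := GeodesicSpace.exists_geodesic x y
  have hd : dist (c a) (c b) = b - a := by
    rw [hc a ⟨le_rfl, hab⟩ b ⟨hab, le_rfl⟩, abs_sub_comm, abs_of_nonneg (sub_nonneg.2 hab)]
  refine ⟨fun s => c (a + s), ⟨dist_nonneg, ?_⟩, by simp, by simp [hd]⟩
  rw [hd]
  rintro s ⟨hs0, hs1⟩ t ⟨ht0, ht1⟩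
  rw [hc _ ⟨by linarith, by linarith⟩ _ ⟨by linarith, by linarith⟩]
  congr 1
  ring

/-- The point `(1 - t) x + t y`, for `t ∈ [0, 1]`: the point `c (t * d(x, y))` on a geodesic
`c : [0, d(x, y)] → X` from `x` to `y`. In a CAT(0) space it does not depend on the choice of the
geodesic, see `geodesicPoint_eq`. -/
noncomputable def geodesicPoint {X : Type*} [MetricSpace X] [GeodesicSpace X]
    (x y : X) (t : ℝ) : X :=
  (GeodesicSpace.exists_normalized x y).choose (t * dist x y)

theorem geodesicPoint_eq {X : Type*} [MetricSpace X] [CAT0Space X] (x y : X) (c : ℝ → X)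
    (hc : IsGeodesic c 0 (dist x y)) (h0 : c 0 = x) (h1 : c (dist x y) = y)
    (t : ℝ) (ht : t ∈ Set.Icc (0 : ℝ) 1) : geodesicPoint x y t = c (t * dist x y) := by
  obtain ⟨hg, hg0, hg1⟩ := (GeodesicSpace.exists_normalized x y).choose_spec
  have hp : geodesicPoint x y t =
      (GeodesicSpace.exists_normalized x y).choose (t * dist x y) := rfl
  generalize (GeodesicSpace.exists_normalized x y).choose = g at hg hg0 hg1 hp
  have hd : 0 ≤ dist x y := dist_nonneg
  have hm : t * dist x y ∈ Set.Icc 0 (dist x y) :=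
    ⟨mul_nonneg ht.1 hd, mul_le_of_le_one_left hd ht.2⟩
  have e0 := hg.2 _ hm 0 ⟨le_rfl, hd⟩
  have e1 := hg.2 _ hm _ ⟨hd, le_rfl⟩
  rw [hg0, ← hp] at e0
  rw [hg1, ← hp] at e1
  have key := CAT0Space.cat0_ineq (geodesicPoint x y t) c 0 (dist x y) hc t ht
  rw [mul_zero, zero_add, h0, h1, e0, e1, sq_abs, sq_abs] at key
  have hz : dist (geodesicPoint x y t) (c (t * dist x y)) ^ 2 ≤ 0 := by
    refine key.trans (le_of_eq ?_)
    ring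
  exact dist_eq_zero.1 (pow_eq_zero_iff two_ne_zero |>.1 (le_antisymm hz (sq_nonneg _)))

/-- `f : X → (-∞, ∞]` is proper: it never takes the value `-∞` and is not identically `∞`. -/
def IsProperFun {X : Type*} (f : X → EReal) : Prop :=
  (∀ x, f x ≠ ⊥) ∧ ∃ x, f x ≠ ⊤

/-- Convexity along geodesics of an extended-real-valued function (with `0 * ∞ = 0`). -/
def IsGeodesicallyConvex {X : Type*} [MetricSpace X] [GeodesicSpace X] (f : X → EReal) : Prop :=
  ∀ x y : X, ∀ t ∈ Set.Icc (0 : ℝ) 1,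
    f (geodesicPoint x y t) ≤ ((1 - t : ℝ) : EReal) * f x + ((t : ℝ) : EReal) * f y

/-- The set of minimizers of `f`. -/
def argminSet {X : Type*} (f : X → EReal) : Set X :=
  {x | f x = ⨅ y, f y}

/-- The function `y ↦ f y + d(x, y)² / (2 γ)`. -/
noncomputable def moreauYosida {X : Type*} [MetricSpace X] (f : X → EReal) (γ : ℝ) (x : X) :
    X → EReal :=
  fun y => f y + ((1 / (2 * γ) * dist x y ^ 2 : ℝ) : EReal)

open Classical in
/-- The Moreau-Yosida resolvent `J_γ x`: the minimizer of `y ↦ f y + d(x, y)² / (2 γ)`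
(with value `x` if there is no minimizer). -/
noncomputable def resolvent_MY {X : Type*} [MetricSpace X] (f : X → EReal) (γ : ℝ) (x : X) : X :=
  if h : (argminSet (moreauYosida f γ x)).Nonempty then h.choose else x

/-- The family `T` of self-mappings is jointly firmly nonexpansive with respect to `γ`. -/
def JointlyFirmlyNonexpansive {X : Type*} [MetricSpace X] [GeodesicSpace X]
    (T : ℕ → X → X) (γ : ℕ → ℝ) : Prop :=
  ∀ n m : ℕ, ∀ x y : X, ∀ α ∈ Set.Icc (0 : ℝ) 1, ∀ β ∈ Set.Icc (0 : ℝ) 1,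
    (1 - α) * γ n = (1 - β) * γ m →
      dist (T n x) (T m y) ≤
        dist (geodesicPoint x (T n x) α) (geodesicPoint y (T m y) β)

/-- `r(y, (u_n)) = limsup d(y, u_n)`; used for bounded sequences only. -/
noncomputable def asymptoticRadiusAt {X : Type*} [MetricSpace X] (u : ℕ → X) (y : X) : ℝ :=
  limsup (fun n => dist y (u n)) atTop

/-- The set of asymptotic centers of a (bounded) sequence `u`. -/
noncomputable def asymptoticCenters {X : Type*} [MetricSpace X] (u : ℕ → X) : Set X :=
  {y | asymptoticRadiusAt u y = ⨅ z : X, asymptoticRadiusAt u z}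

/-- The sequence `u` is bounded and Δ-converges to `x`: `x` is the unique asymptotic center of
every subsequence. -/
def DeltaConverges {X : Type*} [MetricSpace X] (u : ℕ → X) (x : X) : Prop :=
  Bornology.IsBounded (Set.range u) ∧
    ∀ φ : ℕ → ℕ, StrictMono φ → asymptoticCenters (u ∘ φ) = {x}

/-!
Everything rests on the inequality that the CAT(0) condition gives at geodesic points: squared
distances are strongly convex.

*Resolvents.* A lower semicontinuous convex function is bounded below by an affine function of the
distance to a point of its domain (`exists_affine_lower_bound`), so `f + d(x, ·)² / (2γ)` is bounded
below; it is strongly convex, so minimizing sequences are Cauchy and converge to the minimizer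
(`exists_minimizer_of_strongly_convex`). Moving from the minimizer `p` a little towards `z` gives
the variational inequality `2γ (f p - f z) + d(x, p)² + d(p, z)² ≤ d(x, z)²`
(`IsProx.variational`).

*Joint firm nonexpansiveness.* If `p = J_γ x` and `x' = (1 - α) x + α p` then `p = J_{(1-α)γ} x'`
(`IsProx.resolvent_identity`). So both sides concern one and the same parameter
`(1 - α) γ_n = (1 - β) γ_m`, and a resolvent with a fixed parameter is nonexpansive: add the two
variational inequalities and apply Reshetnyak's quadrilateral inequality (`quadrilateral_ineq`).

*Convergence.* The variational inequality at a minimizer `z` shows that `d(u_n, z)` decreases and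
that `∑ γ_n (f(u_{n+1}) - min f)` is bounded; since `∑ γ_n = ∞`, the decreasing sequence `f(u_n)`
tends to `min f`. If `p` is the asymptotic center of a bounded sequence `v` with
`f(v_n) → min f`, the variational inequality for `J_1 p` against `v_n` shows that `J_1 p` is an
asymptotic center too, so `J_1 p = p`, and fixed points of `J_1` are minimizers
(`mem_argminSet_of_mem_asymptoticCenters`). For a minimizer `z` the numbers `d(z, u_n)` converge,
so that the asymptotic radius at `z` is the same for all subsequences; hence all subsequences have
the same asymptotic center.
-/

/-! ### Geodesic points and the quadrilateral inequality -/

section CAT0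

variable {X : Type*} [MetricSpace X]

theorem dist_left_geodesicPoint [GeodesicSpace X] (x y : X) {t : ℝ}
    (ht : t ∈ Set.Icc (0 : ℝ) 1) : dist x (geodesicPoint x y t) = t * dist x y := by
  obtain ⟨hg, hg0, hg1⟩ := (GeodesicSpace.exists_normalized x y).choose_spec
  have hd : 0 ≤ dist x y := dist_nonneg
  have hm : t * dist x y ∈ Set.Icc 0 (dist x y) :=
    ⟨mul_nonneg ht.1 hd, mul_le_of_le_one_left hd ht.2⟩
  have e := hg.2 0 ⟨le_rfl, hd⟩ _ hm
  rw [hg0, zero_sub, abs_neg, abs_of_nonneg hm.1] at e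
  exact e

theorem dist_geodesicPoint_right [GeodesicSpace X] (x y : X) {t : ℝ}
    (ht : t ∈ Set.Icc (0 : ℝ) 1) : dist (geodesicPoint x y t) y = (1 - t) * dist x y := by
  obtain ⟨hg, hg0, hg1⟩ := (GeodesicSpace.exists_normalized x y).choose_spec
  have hd : 0 ≤ dist x y := dist_nonneg
  have hm : t * dist x y ∈ Set.Icc 0 (dist x y) :=
    ⟨mul_nonneg ht.1 hd, mul_le_of_le_one_left hd ht.2⟩
  have e := hg.2 _ hm _ ⟨hd, le_rfl⟩
  rw [hg1, abs_sub_comm, abs_of_nonneg (sub_nonneg.2 hm.2)] at e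
  rw [sub_mul, one_mul]
  exact e

theorem sq_dist_geodesicPoint_le [CAT0Space X] (z x y : X) {t : ℝ}
    (ht : t ∈ Set.Icc (0 : ℝ) 1) :
    dist z (geodesicPoint x y t) ^ 2 ≤
      (1 - t) * dist z x ^ 2 + t * dist z y ^ 2 - t * (1 - t) * dist x y ^ 2 := by
  obtain ⟨hg, hg0, hg1⟩ := (GeodesicSpace.exists_normalized x y).choose_spec
  have key := CAT0Space.cat0_ineq z _ 0 (dist x y) hg t ht
  rw [mul_zero, zero_add, hg0, hg1] at key
  exact key

/-- **Reshetnyak's quadrilateral inequality**, the Cauchy-Schwarz inequality of CAT(0) spaces. -/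
theorem quadrilateral_ineq [CAT0Space X] (x y p q : X) :
    dist x q ^ 2 + dist y p ^ 2 ≤
      dist x p ^ 2 + dist y q ^ 2 + 2 * dist x y * dist p q := by
  rcases eq_or_ne x y with rfl | hxy
  · rw [dist_self]; linarith
  rcases eq_or_ne p q with rfl | hpq
  · rw [dist_self]; linarith
  have ha : 0 < dist x y := dist_pos.2 hxy
  have hb : 0 < dist p q := dist_pos.2 hpq
  -- `y` and `p` are joined through the point that divides the diagonal from `x` to `q` in the
  -- ratio of the sides `xy` and `pq`.
  obtain ⟨t, ht⟩ : ∃ t, t = dist x y / (dist x y + dist p q) := ⟨_, rfl⟩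
  have ht0 : 0 < t := by rw [ht]; positivity
  have h1t : 1 - t = dist p q / (dist x y + dist p q) := by rw [ht]; field_simp; ring
  have ht1 : 0 < 1 - t := by rw [h1t]; positivity
  have hr : (1 - t) * dist x y = t * dist p q := by rw [h1t, ht]; ring
  have hmem : t ∈ Set.Icc (0 : ℝ) 1 := ⟨ht0.le, by linarith⟩
  have h1 := sq_dist_geodesicPoint_le y x q hmem
  have h2 := sq_dist_geodesicPoint_le p x q hmem
  have h3 := dist_triangle_right y p (geodesicPoint x q t)
  have hyp : 0 ≤ dist y p := dist_nonneg
  rw [dist_comm y x] at h1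
  rw [dist_comm p x] at h2
  generalize dist y (geodesicPoint x q t) = u at h1 h3
  generalize dist p (geodesicPoint x q t) = v at h2 h3
  -- `(u + v)² ≤ u² / t + v² / (1 - t)`, with denominators cleared.
  have h4 : t * (1 - t) * dist y p ^ 2 ≤ (1 - t) * u ^ 2 + t * v ^ 2 := by
    have : t * (1 - t) * dist y p ^ 2 ≤ t * (1 - t) * (u + v) ^ 2 := by gcongr
    nlinarith [sq_nonneg ((1 - t) * u - t * v)]
  have h5 := mul_le_mul_of_nonneg_left h1 ht1.le
  have h6 := mul_le_mul_of_nonneg_left h2 ht0.le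
  have h7 : (1 - t) ^ 2 * dist x y ^ 2 = t * (1 - t) * (dist x y * dist p q) := by
    linear_combination (1 - t) * dist x y * hr
  have h8 : t ^ 2 * dist p q ^ 2 = t * (1 - t) * (dist x y * dist p q) := by
    linear_combination (-t) * dist p q * hr
  have h9 : t * (1 - t) * (dist x q ^ 2 + dist y p ^ 2) ≤
      t * (1 - t) * (dist x p ^ 2 + dist y q ^ 2 + 2 * dist x y * dist p q) := by
    nlinarith
  exact le_of_mul_le_mul_left h9 (by positivity)

/-! ### Minimizers of strongly convex functions -/

/-- A strongly midpoint-convex function that is bounded below on `S` has a minimizer on `S`, if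
limits of sequences along which it converges behave as for a lower semicontinuous function. -/
theorem exists_minimizer_of_strongly_convex [CompleteSpace X] {S : Set X} (hS : S.Nonempty)
    {φ : X → ℝ} {c B : ℝ} (hc : 0 < c) (hB : ∀ y ∈ S, B ≤ φ y)
    (hmid : ∀ y ∈ S, ∀ z ∈ S, ∃ m ∈ S, φ m ≤ (φ y + φ z) / 2 - c * dist y z ^ 2)
    (hlim : ∀ (v : ℕ → X) (y : X) (L : ℝ), (∀ n, v n ∈ S) → Tendsto v atTop (𝓝 y) →
      Tendsto (fun n => φ (v n)) atTop (𝓝 L) → y ∈ S ∧ φ y ≤ L) :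
    ∃ p ∈ S, ∀ z ∈ S, φ p ≤ φ z := by
  have hbdd : BddBelow (φ '' S) := ⟨B, by rintro _ ⟨y, hy, rfl⟩; exact hB y hy⟩
  have hI : ∀ z ∈ S, sInf (φ '' S) ≤ φ z := fun z hz => csInf_le hbdd ⟨z, hz, rfl⟩
  generalize hIdef : sInf (φ '' S) = I at hI
  have hex : ∀ n : ℕ, ∃ v ∈ S, φ v < I + 1 / ((n : ℝ) + 1) := by
    intro n
    obtain ⟨_, ⟨v, hv, rfl⟩, h⟩ := exists_lt_of_csInf_lt (hS.image φ)
      (show sInf (φ '' S) < I + 1 / ((n : ℝ) + 1) by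
        rw [hIdef]; exact lt_add_of_pos_right _ (by positivity))
    exact ⟨v, hv, h⟩
  choose v hvS hv using hex
  have hcauchy : CauchySeq v := by
    rw [Metric.cauchySeq_iff']
    intro ε hε
    obtain ⟨N, hN⟩ := exists_nat_one_div_lt (show 0 < c * ε ^ 2 by positivity)
    refine ⟨N, fun n hn => ?_⟩
    obtain ⟨m, hm, hmle⟩ := hmid _ (hvS n) _ (hvS N)
    have h1 := hI m hm
    have h2 := hv n
    have h3 := hv N
    have h4 : 1 / ((n : ℝ) + 1) ≤ 1 / ((N : ℝ) + 1) := by gcongr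
    have h5 : c * dist (v n) (v N) ^ 2 < c * ε ^ 2 := by linarith
    exact lt_of_pow_lt_pow_left₀ 2 hε.le (lt_of_mul_lt_mul_left h5 hc.le)
  obtain ⟨p, hp⟩ := cauchySeq_tendsto_of_complete hcauchy
  have hφ : Tendsto (fun n => φ (v n)) atTop (𝓝 I) := by
    have h0 := (tendsto_one_div_add_atTop_nhds_zero_nat (𝕜 := ℝ)).const_add I
    rw [add_zero] at h0
    exact tendsto_of_tendsto_of_tendsto_of_le_of_le tendsto_const_nhds h0
      (fun n => hI _ (hvS n)) (fun n => (hv n).le)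
  obtain ⟨hpS, hple⟩ := hlim v p I hvS hp hφ
  exact ⟨p, hpS, fun z hz => hple.trans (hI z hz)⟩

theorem mem_argminSet_iff {Y : Type*} {f : Y → EReal} {x : Y} : x ∈ argminSet f ↔ ∀ y, f x ≤ f y :=
  ⟨fun h y => (show f x = _ from h) ▸ iInf_le f y,
    fun h => le_antisymm (le_iInf h) (iInf_le f x)⟩

/-! ### Convex lower semicontinuous functions -/

theorem IsGeodesicallyConvex.toReal_le [GeodesicSpace X] {f : X → EReal}
    (hconv : IsGeodesicallyConvex f) (hbot : ∀ x, f x ≠ ⊥) {x y : X} (hx : f x ≠ ⊤)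
    (hy : f y ≠ ⊤) {t : ℝ} (ht : t ∈ Set.Icc (0 : ℝ) 1) :
    f (geodesicPoint x y t) ≠ ⊤ ∧
      (f (geodesicPoint x y t)).toReal ≤ (1 - t) * (f x).toReal + t * (f y).toReal := by
  have h := hconv x y t ht
  rw [← EReal.coe_toReal hx (hbot x), ← EReal.coe_toReal hy (hbot y), ← EReal.coe_mul,
    ← EReal.coe_mul, ← EReal.coe_add] at h
  have htop : f (geodesicPoint x y t) ≠ ⊤ := ne_top_of_le_ne_top (EReal.coe_ne_top _) h
  refine ⟨htop, ?_⟩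
  rw [← EReal.coe_toReal htop (hbot _)] at h
  exact EReal.coe_le_coe_iff.1 h

theorem LowerSemicontinuous.toReal_le_of_tendsto {f : X → EReal} (hlsc : LowerSemicontinuous f)
    (hbot : ∀ x, f x ≠ ⊥) {v : ℕ → X} {y : X} {L : ℝ} (hv : ∀ n, f (v n) ≠ ⊤)
    (hvy : Tendsto v atTop (𝓝 y)) (hL : Tendsto (fun n => (f (v n)).toReal) atTop (𝓝 L)) :
    f y ≠ ⊤ ∧ (f y).toReal ≤ L := by
  have h : f y ≤ (L : EReal) := by
    by_contra! hlt
    obtain ⟨c, hc1, hc2⟩ := EReal.lt_iff_exists_real_btwn.1 hlt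
    have hev := hvy.eventually (hlsc y c hc2)
    have : c ≤ L := by
      refine ge_of_tendsto hL (hev.mono fun n hn => ?_)
      change (c : EReal) < f (v n) at hn
      rw [← EReal.coe_toReal (hv n) (hbot _)] at hn
      exact (EReal.coe_lt_coe_iff.1 hn).le
    exact absurd (EReal.coe_lt_coe_iff.1 hc1) (not_lt.2 this)
  have htop : f y ≠ ⊤ := ne_top_of_le_ne_top (EReal.coe_ne_top _) h
  rw [← EReal.coe_toReal htop (hbot _)] at h
  exact ⟨htop, EReal.coe_le_coe_iff.1 h⟩

/-- Lower semicontinuity bounds `f` from below near `x`; convexity along geodesics from `x`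
propagates this to an affine bound everywhere. -/
theorem exists_affine_lower_bound [GeodesicSpace X] {f : X → EReal}
    (hbot : ∀ x, f x ≠ ⊥) (hconv : IsGeodesicallyConvex f) (hlsc : LowerSemicontinuous f)
    {x : X} (hx : f x ≠ ⊤) :
    ∃ a, 0 ≤ a ∧ ∀ y, f y ≠ ⊤ → (f x).toReal - 1 - a * dist x y ≤ (f y).toReal := by
  have hlt : (((f x).toReal - 1 : ℝ) : EReal) < f x := by
    conv_rhs => rw [← EReal.coe_toReal hx (hbot x)]
    exact EReal.coe_lt_coe_iff.2 (by linarith)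
  obtain ⟨r, hr, hball⟩ := Metric.eventually_nhds_iff.1 (hlsc x _ hlt)
  have hnear : ∀ y, f y ≠ ⊤ → dist x y < r → (f x).toReal - 1 < (f y).toReal := by
    intro y hy hxy
    have h : (((f x).toReal - 1 : ℝ) : EReal) < f y := hball (by rwa [dist_comm])
    rw [← EReal.coe_toReal hy (hbot y)] at h
    exact EReal.coe_lt_coe_iff.1 h
  refine ⟨2 / r, by positivity, fun y hy => ?_⟩
  rcases lt_or_ge (dist x y) r with h | h
  · have := hnear y hy h
    have : 0 ≤ 2 / r * dist x y := by positivity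
    linarith
  · have hD : 0 < dist x y := hr.trans_le h
    obtain ⟨t, ht⟩ : ∃ t, t = r / (2 * dist x y) := ⟨_, rfl⟩
    have ht0 : 0 < t := by rw [ht]; positivity
    have ht1 : t ≤ 1 := by rw [ht, div_le_one (by positivity)]; linarith
    have htD : t * dist x y = r / 2 := by rw [ht]; field_simp
    have hmem : t ∈ Set.Icc (0 : ℝ) 1 := ⟨ht0.le, ht1⟩
    obtain ⟨hm, hmle⟩ := hconv.toReal_le hbot hx hy hmem
    have h1 := hnear _ hm (by rw [dist_left_geodesicPoint x y hmem, htD]; linarith)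
    have h2 : t * (2 / r * dist x y) = 1 := by
      rw [mul_left_comm, htD]; field_simp
    have h3 : t * ((f x).toReal - 1 - 2 / r * dist x y) ≤ t * (f y).toReal := by
      nlinarith
    exact le_of_mul_le_mul_left h3 ht0

/-! ### Proximal points -/

/-- `p` minimizes `f + d(x, ·)² / (2γ)`, expressed by real numbers: `p` is in the domain
`{f ≠ ⊤}`, and the minimization, multiplied by `2γ`, is over that domain. -/
def IsProx (f : X → EReal) (γ : ℝ) (x p : X) : Prop :=
  f p ≠ ⊤ ∧ ∀ z, f z ≠ ⊤ →
    2 * γ * (f p).toReal + dist x p ^ 2 ≤ 2 * γ * (f z).toReal + dist x z ^ 2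

theorem mem_argminSet_moreauYosida_iff {f : X → EReal} (hf : IsProperFun f) {γ : ℝ} (hγ : 0 < γ)
    {x p : X} : p ∈ argminSet (moreauYosida f γ x) ↔ IsProx f γ x p := by
  have hcoe : ∀ z, f z ≠ ⊤ → moreauYosida f γ x z =
      (((f z).toReal + 1 / (2 * γ) * dist x z ^ 2 : ℝ) : EReal) := by
    intro z hz
    rw [EReal.coe_add, EReal.coe_toReal hz (hf.1 z), moreauYosida]
  have hscale : ∀ a b c d : ℝ, a + 1 / (2 * γ) * b ≤ c + 1 / (2 * γ) * d ↔
      2 * γ * a + b ≤ 2 * γ * c + d := by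
    intro a b c d
    rw [← mul_le_mul_iff_right₀ (show 0 < 2 * γ by positivity)]
    have e : ∀ s w : ℝ, 2 * γ * (s + 1 / (2 * γ) * w) = 2 * γ * s + w := by
      intro s w; field_simp
    rw [e, e]
  rw [mem_argminSet_iff]
  constructor
  · intro h
    have hp : f p ≠ ⊤ := by
      obtain ⟨z, hz⟩ := hf.2
      intro hp
      have h1 := h z
      rw [hcoe z hz, moreauYosida, hp, EReal.top_add_coe] at h1
      exact EReal.coe_ne_top _ (top_le_iff.1 h1)
    refine ⟨hp, fun z hz => ?_⟩
    have h1 := h z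
    rw [hcoe z hz, hcoe p hp] at h1
    exact (hscale _ _ _ _).1 (EReal.coe_le_coe_iff.1 h1)
  · rintro ⟨hp, h⟩ z
    by_cases hz : f z = ⊤
    · rw [moreauYosida, moreauYosida, hz, EReal.top_add_coe]
      exact le_top
    · rw [hcoe z hz, hcoe p hp]
      exact EReal.coe_le_coe_iff.2 ((hscale _ _ _ _).2 (h z hz))

theorem IsProx.variational [CAT0Space X] {f : X → EReal} (hbot : ∀ x, f x ≠ ⊥)
    (hconv : IsGeodesicallyConvex f) {γ : ℝ} (hγ : 0 < γ) {x p : X} (h : IsProx f γ x p)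
    {z : X} (hz : f z ≠ ⊤) :
    2 * γ * ((f p).toReal - (f z).toReal) + dist x p ^ 2 + dist p z ^ 2 ≤ dist x z ^ 2 := by
  -- Compare `p` with the point at parameter `t` from `p` to `z`, divide by `t`, and let `t → 0`.
  have hle : ∀ t ∈ Set.Ioc (0 : ℝ) 1,
      2 * γ * ((f p).toReal - (f z).toReal) + dist x p ^ 2 + (1 - t) * dist p z ^ 2 ≤
        dist x z ^ 2 := by
    intro t ht
    have hmem : t ∈ Set.Icc (0 : ℝ) 1 := ⟨ht.1.le, ht.2⟩
    obtain ⟨hm, hmle⟩ := hconv.toReal_le hbot h.1 hz hmem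
    have h1 := h.2 _ hm
    have h2 := sq_dist_geodesicPoint_le x p z hmem
    have h3 := mul_le_mul_of_nonneg_left hmle (show 0 ≤ 2 * γ by positivity)
    have h4 : t * (2 * γ * ((f p).toReal - (f z).toReal) + dist x p ^ 2 +
        (1 - t) * dist p z ^ 2) ≤ t * dist x z ^ 2 := by linarith
    exact le_of_mul_le_mul_left h4 ht.1
  have hcont : Tendsto (fun t : ℝ => 2 * γ * ((f p).toReal - (f z).toReal) + dist x p ^ 2 +
      (1 - t) * dist p z ^ 2) (𝓝[>] 0)
      (𝓝 (2 * γ * ((f p).toReal - (f z).toReal) + dist x p ^ 2 + (1 - 0) * dist p z ^ 2)) :=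
    Tendsto.mono_left (Continuous.tendsto (by fun_prop) 0) nhdsWithin_le_nhds
  rw [sub_zero, one_mul] at hcont
  exact le_of_tendsto hcont
    (by filter_upwards [Ioc_mem_nhdsGT (zero_lt_one (α := ℝ))] with t ht using hle t ht)

theorem IsProx.unique [CAT0Space X] {f : X → EReal} (hbot : ∀ x, f x ≠ ⊥)
    (hconv : IsGeodesicallyConvex f) {γ : ℝ} (hγ : 0 < γ) {x p q : X} (hp : IsProx f γ x p)
    (hq : IsProx f γ x q) : p = q := by
  have h1 := hp.variational hbot hconv hγ hq.1
  have h2 := hq.2 _ hp.1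
  exact dist_eq_zero.1 (pow_eq_zero_iff two_ne_zero |>.1
    (le_antisymm (by linarith) (sq_nonneg _)))

theorem exists_isProx [CompleteSpace X] [CAT0Space X] {f : X → EReal} (hf : IsProperFun f)
    (hconv : IsGeodesicallyConvex f) (hlsc : LowerSemicontinuous f) {γ : ℝ} (hγ : 0 < γ) (x : X) :
    ∃ p, IsProx f γ x p := by
  have hbot := hf.1
  obtain ⟨x₀, hx₀⟩ := hf.2
  obtain ⟨a, ha, hlow⟩ := exists_affine_lower_bound hbot hconv hlsc hx₀
  have hhalf : (1 / 2 : ℝ) ∈ Set.Icc (0 : ℝ) 1 := by norm_num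
  refine exists_minimizer_of_strongly_convex (S := {y | f y ≠ ⊤}) ⟨x₀, hx₀⟩
    (φ := fun y => 2 * γ * (f y).toReal + dist x y ^ 2) (c := 1 / 4)
    (B := 2 * γ * ((f x₀).toReal - 1 - a * dist x₀ x) - (γ * a) ^ 2) (by norm_num) ?_ ?_ ?_
  · intro y hy
    have h1 := hlow y hy
    have h2 : a * dist x₀ y ≤ a * (dist x₀ x + dist x y) := by
      gcongr
      exact dist_triangle _ _ _
    have h3 : 2 * γ * ((f x₀).toReal - 1 - a * (dist x₀ x + dist x y)) ≤
        2 * γ * (f y).toReal := by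
      gcongr
      linarith
    change _ ≤ 2 * γ * (f y).toReal + dist x y ^ 2
    linarith [sq_nonneg (dist x y - γ * a)]
  · intro y hy z hz
    obtain ⟨hm, hmle⟩ := hconv.toReal_le hbot hy hz hhalf
    refine ⟨_, hm, ?_⟩
    have h2 := sq_dist_geodesicPoint_le x y z hhalf
    have h3 := mul_le_mul_of_nonneg_left hmle (show 0 ≤ 2 * γ by positivity)
    change 2 * γ * (f (geodesicPoint y z (1 / 2))).toReal + _ ≤ _
    linarith
  · intro v y L hv hvy hL
    have hd : Tendsto (fun n => dist x (v n) ^ 2) atTop (𝓝 (dist x y ^ 2)) :=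
      (tendsto_const_nhds.dist hvy).pow 2
    have h1 : Tendsto (fun n => (f (v n)).toReal) atTop
        (𝓝 ((L - dist x y ^ 2) / (2 * γ))) := by
      refine ((hL.sub hd).div_const (2 * γ)).congr fun n => ?_
      field_simp
      ring
    obtain ⟨hy, hyle⟩ := hlsc.toReal_le_of_tendsto hbot hv hvy h1
    refine ⟨hy, ?_⟩
    rw [le_div_iff₀ (by positivity)] at hyle
    linarith

theorem argminSet_moreauYosida_eq [CompleteSpace X] [CAT0Space X] {f : X → EReal}
    (hf : IsProperFun f) (hconv : IsGeodesicallyConvex f) (hlsc : LowerSemicontinuous f) {γ : ℝ}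
    (hγ : 0 < γ) (x : X) : argminSet (moreauYosida f γ x) = {resolvent_MY f γ x} := by
  have hne : (argminSet (moreauYosida f γ x)).Nonempty := by
    obtain ⟨p, hp⟩ := exists_isProx hf hconv hlsc hγ x
    exact ⟨p, (mem_argminSet_moreauYosida_iff hf hγ).2 hp⟩
  have hmem : resolvent_MY f γ x ∈ argminSet (moreauYosida f γ x) := by
    rw [resolvent_MY, dif_pos hne]
    exact hne.choose_spec
  refine Set.eq_singleton_iff_unique_mem.2 ⟨hmem, fun y hy => ?_⟩
  exact ((mem_argminSet_moreauYosida_iff hf hγ).1 hy).unique hf.1 hconv hγ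
    ((mem_argminSet_moreauYosida_iff hf hγ).1 hmem)

theorem isProx_resolvent_MY [CompleteSpace X] [CAT0Space X] {f : X → EReal}
    (hf : IsProperFun f) (hconv : IsGeodesicallyConvex f) (hlsc : LowerSemicontinuous f) {γ : ℝ}
    (hγ : 0 < γ) (x : X) : IsProx f γ x (resolvent_MY f γ x) := by
  rw [← mem_argminSet_moreauYosida_iff hf hγ, argminSet_moreauYosida_eq hf hconv hlsc hγ]
  exact Set.mem_singleton _

/-! ### Joint firm nonexpansiveness -/

/-- The resolvent identity `J_γ x = J_{(1-α)γ} ((1 - α) x + α J_γ x)`. -/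
theorem IsProx.resolvent_identity [GeodesicSpace X] {f : X → EReal} {γ : ℝ} {x p : X}
    (h : IsProx f γ x p) {α : ℝ} (hα : α ∈ Set.Icc (0 : ℝ) 1) :
    IsProx f ((1 - α) * γ) (geodesicPoint x p α) p := by
  refine ⟨h.1, fun z hz => ?_⟩
  have h1 := mul_le_mul_of_nonneg_left (h.2 z hz) (sub_nonneg.2 hα.2)
  have h2 : dist x z ≤ α * dist x p + dist (geodesicPoint x p α) z :=
    dist_left_geodesicPoint x p hα ▸ dist_triangle _ _ _
  rw [dist_geodesicPoint_right x p hα]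
  have hxz : 0 ≤ dist x z := dist_nonneg
  generalize dist (geodesicPoint x p α) z = e at h2 ⊢
  have h3 : (1 - α) * dist x z ^ 2 ≤ (1 - α) * (α * dist x p + e) ^ 2 := by
    have := sub_nonneg.2 hα.2
    gcongr
  have h4 := mul_nonneg hα.1 (sq_nonneg (e - (1 - α) * dist x p))
  linarith

theorem IsProx.dist_le [CAT0Space X] {f : X → EReal} (hbot : ∀ x, f x ≠ ⊥)
    (hconv : IsGeodesicallyConvex f) {γ : ℝ} (hγ : 0 < γ) {x y p q : X} (hp : IsProx f γ x p)
    (hq : IsProx f γ y q) : dist p q ≤ dist x y := by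
  have h1 := hp.variational hbot hconv hγ hq.1
  have h2 := hq.variational hbot hconv hγ hp.1
  have h3 := quadrilateral_ineq x y p q
  rw [dist_comm q p] at h2
  by_contra! hlt
  have hpos : 0 < dist p q := dist_nonneg.trans_lt hlt
  nlinarith

theorem jointlyFirmlyNonexpansive_resolvent_MY [CompleteSpace X] [CAT0Space X] {f : X → EReal}
    (hf : IsProperFun f) (hconv : IsGeodesicallyConvex f) (hlsc : LowerSemicontinuous f)
    {γ : ℕ → ℝ} (hγ : ∀ n, 0 < γ n) :
    JointlyFirmlyNonexpansive (fun n => resolvent_MY f (γ n)) γ := by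
  intro n m x y α hα β hβ heq
  have hp := isProx_resolvent_MY hf hconv hlsc (hγ n) x
  have hq := isProx_resolvent_MY hf hconv hlsc (hγ m) y
  rcases hα.2.lt_or_eq with hα1 | rfl
  · have hq' := hq.resolvent_identity hβ
    rw [← heq] at hq'
    exact (hp.resolvent_identity hα).dist_le hf.1 hconv (mul_pos (sub_pos.2 hα1) (hγ n)) hq'
  · -- For `α = 1` also `β = 1`, and the geodesic points are the resolvent values themselves.
    have hβ1 : β = 1 := by
      rw [sub_self, zero_mul] at heq
      have := (mul_eq_zero.1 heq.symm).resolve_right (hγ m).ne'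
      linarith
    subst hβ1
    have e : ∀ a b : X, geodesicPoint a b 1 = b := fun a b =>
      dist_eq_zero.1 (by rw [dist_geodesicPoint_right a b hα, sub_self, zero_mul])
    rw [e, e]

/-! ### Asymptotic centers -/

theorem isBoundedUnder_le_dist {u : ℕ → X} (hu : Bornology.IsBounded (Set.range u)) (y : X) :
    IsBoundedUnder (· ≤ ·) atTop (fun n => dist y (u n)) := by
  obtain ⟨C, hC⟩ := hu.subset_closedBall y
  refine isBoundedUnder_of ⟨C, fun n => ?_⟩
  have h := hC ⟨n, rfl⟩
  rwa [Metric.mem_closedBall'] at h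

theorem isCoboundedUnder_le_dist (u : ℕ → X) (y : X) :
    IsCoboundedUnder (· ≤ ·) atTop (fun n => dist y (u n)) :=
  (isBoundedUnder_of ⟨0, fun _ => dist_nonneg⟩ :
    IsBoundedUnder (· ≥ ·) atTop fun n => dist y (u n)).isCoboundedUnder_flip

theorem asymptoticRadiusAt_nonneg {u : ℕ → X} (hu : Bornology.IsBounded (Set.range u)) (y : X) :
    0 ≤ asymptoticRadiusAt u y :=
  le_limsup_of_frequently_le (Frequently.of_forall fun _ => dist_nonneg)
    (isBoundedUnder_le_dist hu y)

theorem eventually_sq_dist_le {u : ℕ → X} (hu : Bornology.IsBounded (Set.range u)) (y : X)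
    {ε : ℝ} (hε : 0 < ε) : ∀ᶠ n in atTop, dist y (u n) ^ 2 ≤ asymptoticRadiusAt u y ^ 2 + ε := by
  have h0 := asymptoticRadiusAt_nonneg hu y
  have hlt : asymptoticRadiusAt u y < √(asymptoticRadiusAt u y ^ 2 + ε) :=
    Real.lt_sqrt_of_sq_lt (by linarith)
  filter_upwards [eventually_lt_of_limsup_lt hlt (isBoundedUnder_le_dist hu y)] with n hn
  exact (Real.le_sqrt dist_nonneg (by positivity)).1 hn.le

theorem sq_asymptoticRadiusAt_le {u : ℕ → X} (hu : Bornology.IsBounded (Set.range u)) {y : X}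
    {K : ℝ} (h : ∀ ε > 0, ∀ᶠ n in atTop, dist y (u n) ^ 2 ≤ K + ε) :
    asymptoticRadiusAt u y ^ 2 ≤ K := by
  refine le_of_forall_pos_le_add fun ε hε => ?_
  obtain ⟨n, hn⟩ := (h ε hε).exists
  have hK : 0 ≤ K + ε := (sq_nonneg _).trans hn
  refine (Real.le_sqrt (asymptoticRadiusAt_nonneg hu y) hK).1 ?_
  refine limsup_le_of_le (isCoboundedUnder_le_dist u y) ?_
  filter_upwards [h ε hε] with n hn
  exact (Real.le_sqrt dist_nonneg hK).2 hn

theorem asymptoticRadiusAt_le_add_dist {u : ℕ → X} (hu : Bornology.IsBounded (Set.range u))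
    (y z : X) : asymptoticRadiusAt u y ≤ asymptoticRadiusAt u z + dist y z := by
  refine le_of_forall_pos_le_add fun ε hε => ?_
  refine limsup_le_of_le (isCoboundedUnder_le_dist u y) ?_
  have hlt : asymptoticRadiusAt u z < asymptoticRadiusAt u z + ε := by linarith
  filter_upwards [eventually_lt_of_limsup_lt hlt (isBoundedUnder_le_dist hu z)] with n hn
  have := dist_triangle y z (u n)
  linarith

theorem continuous_asymptoticRadiusAt {u : ℕ → X} (hu : Bornology.IsBounded (Set.range u)) :
    Continuous (asymptoticRadiusAt u) := by
  refine (LipschitzWith.of_le_add fun y z => ?_).continuous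
  exact asymptoticRadiusAt_le_add_dist hu y z

theorem mem_asymptoticCenters_iff {u : ℕ → X} (hu : Bornology.IsBounded (Set.range u)) {y : X} :
    y ∈ asymptoticCenters u ↔ ∀ z, asymptoticRadiusAt u y ≤ asymptoticRadiusAt u z := by
  have hbdd : BddBelow (Set.range fun z => asymptoticRadiusAt u z) :=
    ⟨0, by rintro _ ⟨z, rfl⟩; exact asymptoticRadiusAt_nonneg hu z⟩
  have : Nonempty X := ⟨y⟩
  exact ⟨fun h z => (show asymptoticRadiusAt u y = _ from h) ▸ ciInf_le hbdd z,
    fun h => le_antisymm (le_ciInf h) (ciInf_le hbdd y)⟩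

theorem sq_asymptoticRadiusAt_midpoint_le [CAT0Space X] {u : ℕ → X}
    (hu : Bornology.IsBounded (Set.range u)) (y z : X) :
    asymptoticRadiusAt u (geodesicPoint y z (1 / 2)) ^ 2 ≤
      (asymptoticRadiusAt u y ^ 2 + asymptoticRadiusAt u z ^ 2) / 2 - 1 / 4 * dist y z ^ 2 := by
  refine sq_asymptoticRadiusAt_le hu fun ε hε => ?_
  filter_upwards [eventually_sq_dist_le hu y hε, eventually_sq_dist_le hu z hε] with n h1 h2
  have h3 := sq_dist_geodesicPoint_le (u n) y z (t := 1 / 2) (by norm_num)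
  rw [dist_comm _ (u n)]
  rw [dist_comm _ (u n)] at h1 h2
  linarith

theorem exists_asymptoticCenters_eq_singleton [CompleteSpace X] [CAT0Space X] {u : ℕ → X}
    (hu : Bornology.IsBounded (Set.range u)) : ∃ p, asymptoticCenters u = {p} := by
  have h0 := asymptoticRadiusAt_nonneg hu
  obtain ⟨p, -, hp⟩ := exists_minimizer_of_strongly_convex (S := Set.univ)
    (φ := fun y => asymptoticRadiusAt u y ^ 2) (c := 1 / 4) (B := 0) ⟨u 0, trivial⟩
    (by norm_num) (fun y _ => sq_nonneg _)
    (fun y _ z _ => ⟨_, trivial, sq_asymptoticRadiusAt_midpoint_le hu y z⟩)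
    (fun v y L _ hvy hL => ⟨trivial, (tendsto_nhds_unique hL
      ((((continuous_asymptoticRadiusAt hu).pow 2).tendsto y).comp hvy)).ge⟩)
  refine ⟨p, Set.eq_singleton_iff_unique_mem.2 ⟨?_, fun q hq => ?_⟩⟩
  · exact (mem_asymptoticCenters_iff hu).2 fun z =>
      (pow_le_pow_iff_left₀ (h0 p) (h0 z) two_ne_zero).1 (hp z trivial)
  · rw [mem_asymptoticCenters_iff hu] at hq
    have h1 := sq_asymptoticRadiusAt_midpoint_le hu q p
    have h2 := hp (geodesicPoint q p (1 / 2)) trivial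
    have h3 : asymptoticRadiusAt u q ^ 2 ≤ asymptoticRadiusAt u p ^ 2 :=
      pow_le_pow_left₀ (h0 q) (hq p) 2
    exact dist_eq_zero.1 (pow_eq_zero_iff two_ne_zero |>.1
      (le_antisymm (by linarith) (sq_nonneg _)))

theorem mem_argminSet_of_mem_asymptoticCenters [CompleteSpace X] [CAT0Space X] {f : X → EReal}
    (hf : IsProperFun f) (hconv : IsGeodesicallyConvex f) (hlsc : LowerSemicontinuous f)
    {z : X} (hz : z ∈ argminSet f) {v : ℕ → X} (hv : Bornology.IsBounded (Set.range v))
    (hvf : ∀ ε > 0, ∀ᶠ n in atTop, f (v n) ≠ ⊤ ∧ (f (v n)).toReal ≤ (f z).toReal + ε)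
    {p : X} (hp : p ∈ asymptoticCenters v) : p ∈ argminSet f := by
  rw [mem_argminSet_iff] at hz
  obtain ⟨q, hq⟩ := exists_isProx hf hconv hlsc one_pos p
  have hle : (f z).toReal ≤ (f q).toReal := EReal.toReal_le_toReal (hz q) (hf.1 z) hq.1
  have hrad : asymptoticRadiusAt v q ^ 2 ≤ asymptoticRadiusAt v p ^ 2 := by
    refine sq_asymptoticRadiusAt_le hv fun ε hε => ?_
    filter_upwards [hvf (ε / 4) (by positivity),
      eventually_sq_dist_le hv p (show 0 < ε / 2 by positivity)] with n h1 h2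
    have h3 := hq.variational hf.1 hconv one_pos h1.1
    linarith [sq_nonneg (dist p q)]
  have hqc : q ∈ asymptoticCenters v := by
    rw [mem_asymptoticCenters_iff hv] at hp ⊢
    intro y
    exact ((pow_le_pow_iff_left₀ (asymptoticRadiusAt_nonneg hv q)
      (asymptoticRadiusAt_nonneg hv p) two_ne_zero).1 hrad).trans (hp y)
  obtain ⟨c, hc⟩ := exists_asymptoticCenters_eq_singleton hv
  rw [hc, Set.mem_singleton_iff] at hp hqc
  subst hp
  subst hqc
  rw [mem_argminSet_iff]
  intro y
  by_cases hy : f y = ⊤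
  · rw [hy]; exact le_top
  · have h := hq.variational hf.1 hconv one_pos hy
    rw [← EReal.coe_toReal hq.1 (hf.1 _), ← EReal.coe_toReal hy (hf.1 _),
      EReal.coe_le_coe_iff]
    rw [dist_self] at h
    linarith

/-! ### The proximal point iteration -/

section Iteration

variable [CAT0Space X] {f : X → EReal} {γ : ℕ → ℝ} {u : ℕ → X} {z : X}

theorem proximal_iteration_step (hf : IsProperFun f) (hconv : IsGeodesicallyConvex f)
    (hγ : ∀ n, 0 < γ n) (hu : ∀ n, IsProx f (γ n) (u n) (u (n + 1))) (hz : z ∈ argminSet f)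
    (n : ℕ) :
    f z ≠ ⊤ ∧ (f z).toReal ≤ (f (u (n + 1))).toReal ∧
    2 * γ n * ((f (u (n + 1))).toReal - (f z).toReal) + dist (u (n + 1)) z ^ 2 ≤
      dist (u n) z ^ 2 := by
  rw [mem_argminSet_iff] at hz
  have hztop : f z ≠ ⊤ := ne_top_of_le_ne_top (hu n).1 (hz _)
  refine ⟨hztop, EReal.toReal_le_toReal (hz _) (hf.1 z) (hu n).1, ?_⟩
  have h := (hu n).variational hf.1 hconv (hγ n) hztop
  linarith [sq_nonneg (dist (u n) (u (n + 1)))]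

/-- The iteration is Fejér monotone with respect to the minimizers of `f`. -/
theorem antitone_dist_proximal_iteration (hf : IsProperFun f) (hconv : IsGeodesicallyConvex f)
    (hγ : ∀ n, 0 < γ n) (hu : ∀ n, IsProx f (γ n) (u n) (u (n + 1))) (hz : z ∈ argminSet f) :
    Antitone fun n => dist z (u n) := by
  refine antitone_nat_of_succ_le fun n => ?_
  obtain ⟨-, h1, h2⟩ := proximal_iteration_step hf hconv hγ hu hz n
  have h3 := mul_nonneg (mul_nonneg zero_le_two (hγ n).le) (sub_nonneg.2 h1)
  rw [dist_comm z, dist_comm z]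
  exact le_of_sq_le_sq (by linarith) dist_nonneg

/-- The iteration minimizes `f`. Its starting point may lie outside the domain of `f`, so finiteness
of `f (u n)` is part of the conclusion. -/
theorem proximal_iteration_minimizing (hf : IsProperFun f) (hconv : IsGeodesicallyConvex f)
    (hγ : ∀ n, 0 < γ n) (hu : ∀ n, IsProx f (γ n) (u n) (u (n + 1))) (hz : z ∈ argminSet f)
    (hsum : Tendsto (fun N => ∑ n ∈ Finset.range N, γ n ^ 2) atTop atTop) {ε : ℝ} (hε : 0 < ε) :
    ∀ᶠ n in atTop, f (u n) ≠ ⊤ ∧ (f (u n)).toReal ≤ (f z).toReal + ε := by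
  have hanti : Antitone fun n => (f (u (n + 1))).toReal := by
    refine antitone_nat_of_succ_le fun n => ?_
    have h := (hu (n + 1)).2 _ (hu n).1
    rw [dist_self] at h
    have h1 : 2 * γ (n + 1) * (f (u (n + 1 + 1))).toReal ≤
        2 * γ (n + 1) * (f (u (n + 1))).toReal := by
      linarith [sq_nonneg (dist (u (n + 1)) (u (n + 1 + 1)))]
    exact le_of_mul_le_mul_left h1 (mul_pos two_pos (hγ _))
  obtain ⟨k, hk⟩ : ∃ k, (f (u (k + 1))).toReal ≤ (f z).toReal + ε := by
    by_contra! hcon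
    have hbound : ∀ N, 2 * ε * ∑ n ∈ Finset.range N, γ n + dist (u N) z ^ 2 ≤
        dist (u 0) z ^ 2 := by
      intro N
      induction N with
      | zero => simp
      | succ N ih =>
        rw [Finset.sum_range_succ]
        obtain ⟨-, -, h⟩ := proximal_iteration_step hf hconv hγ hu hz N
        have h1 : 2 * γ N * ε ≤ 2 * γ N * ((f (u (N + 1))).toReal - (f z).toReal) := by
          have := (hγ N).le
          gcongr
          linarith [hcon N]
        linarith
    -- The sum of squares is at most the square of the sum, so it would be bounded as well.
    obtain ⟨N, hN⟩ := (hsum.eventually_gt_atTop ((dist (u 0) z ^ 2 / (2 * ε)) ^ 2)).exists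
    have h0 : 0 ≤ ∑ n ∈ Finset.range N, γ n := Finset.sum_nonneg fun n _ => (hγ n).le
    have h1 : ∑ n ∈ Finset.range N, γ n ≤ dist (u 0) z ^ 2 / (2 * ε) := by
      rw [le_div_iff₀ (by positivity)]
      linarith [hbound N, sq_nonneg (dist (u N) z)]
    have h2 : ∑ n ∈ Finset.range N, γ n ^ 2 ≤ (∑ n ∈ Finset.range N, γ n) ^ 2 :=
      Finset.sum_sq_le_sq_sum_of_nonneg fun n _ => (hγ n).le
    exact absurd (h2.trans (pow_le_pow_left₀ h0 h1 2)) (not_le.2 hN)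
  filter_upwards [eventually_ge_atTop (k + 1)] with n hn
  obtain ⟨m, rfl⟩ : ∃ m, n = m + 1 := ⟨n - 1, by omega⟩
  exact ⟨(hu m).1, (hanti (show k ≤ m by omega)).trans hk⟩

theorem exists_deltaConverges_proximal_iteration [CompleteSpace X] (hf : IsProperFun f)
    (hconv : IsGeodesicallyConvex f) (hlsc : LowerSemicontinuous f)
    (hγ : ∀ n, 0 < γ n) (hu : ∀ n, IsProx f (γ n) (u n) (u (n + 1))) (hz : z ∈ argminSet f)
    (hsum : Tendsto (fun N => ∑ n ∈ Finset.range N, γ n ^ 2) atTop atTop) :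
    ∃ p ∈ argminSet f, DeltaConverges u p := by
  have hbdd : Bornology.IsBounded (Set.range u) := by
    refine Metric.isBounded_closedBall.subset (?_ : _ ⊆ Metric.closedBall z (dist z (u 0)))
    rintro _ ⟨n, rfl⟩
    rw [Metric.mem_closedBall']
    exact antitone_dist_proximal_iteration hf hconv hγ hu hz (Nat.zero_le n)
  have hbddφ : ∀ φ : ℕ → ℕ, Bornology.IsBounded (Set.range (u ∘ φ)) := fun φ =>
    hbdd.subset (Set.range_comp_subset_range φ u)
  have hcenter : ∀ φ : ℕ → ℕ, StrictMono φ → ∀ p ∈ asymptoticCenters (u ∘ φ),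
      p ∈ argminSet f := fun φ hφ p hp =>
    mem_argminSet_of_mem_asymptoticCenters hf hconv hlsc hz (hbddφ φ) (fun ε hε =>
      hφ.tendsto_atTop.eventually
        (proximal_iteration_minimizing hf hconv hγ hu hz hsum hε)) hp
  have hrad : ∀ y ∈ argminSet f, ∀ φ : ℕ → ℕ, StrictMono φ →
      asymptoticRadiusAt (u ∘ φ) y = asymptoticRadiusAt u y := by
    intro y hy φ hφ
    have hlim := tendsto_atTop_ciInf (antitone_dist_proximal_iteration hf hconv hγ hu hy)
      ⟨0, by rintro _ ⟨n, rfl⟩; exact dist_nonneg⟩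
    exact (hlim.comp hφ.tendsto_atTop).limsup_eq.trans hlim.limsup_eq.symm
  obtain ⟨p, hp⟩ := exists_asymptoticCenters_eq_singleton hbdd
  have hpmem : p ∈ asymptoticCenters u := hp ▸ Set.mem_singleton p
  have hpmin : p ∈ argminSet f := hcenter id strictMono_id p hpmem
  refine ⟨p, hpmin, hbdd, fun φ hφ => ?_⟩
  obtain ⟨q, hq⟩ := exists_asymptoticCenters_eq_singleton (hbddφ φ)
  have hqmem : q ∈ asymptoticCenters (u ∘ φ) := hq ▸ Set.mem_singleton q
  have hqmin := hcenter φ hφ q hqmem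
  rw [mem_asymptoticCenters_iff (hbddφ φ)] at hqmem
  have hqu : q ∈ asymptoticCenters u := by
    rw [mem_asymptoticCenters_iff hbdd] at hpmem ⊢
    intro y
    have h := hqmem p
    rw [hrad q hqmin φ hφ, hrad p hpmin φ hφ] at h
    exact h.trans (hpmem y)
  rw [hp, Set.mem_singleton_iff] at hqu
  rw [hq, hqu]

end Iteration

end CAT0

theorem theorem3p19 {X : Type*} [MetricSpace X] [CompleteSpace X] [CAT0Space X]
    (f : X → EReal) (hproper : IsProperFun f) (hconv : IsGeodesicallyConvex f)
    (hlsc : LowerSemicontinuous f) :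
    -- the resolvents are well defined
    (∀ γ : ℝ, 0 < γ → ∀ x : X, argminSet (moreauYosida f γ x) = {resolvent_MY f γ x}) ∧
    -- they form jointly firmly nonexpansive families
    (∀ γ : ℕ → ℝ, (∀ n, 0 < γ n) →
      JointlyFirmlyNonexpansive (fun n => resolvent_MY f (γ n)) γ) ∧
    -- convergence of the proximal point iteration
    ((argminSet f).Nonempty → ∀ γ : ℕ → ℝ, (∀ n, 0 < γ n) →
      Tendsto (fun N => ∑ n ∈ Finset.range N, γ n ^ 2) atTop atTop →
      ∀ u : ℕ → X, (∀ n, u (n + 1) = resolvent_MY f (γ n) (u n)) →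
        ∃ p ∈ argminSet f, DeltaConverges u p) := by
  refine ⟨fun γ hγ x => argminSet_moreauYosida_eq hproper hconv hlsc hγ x,
    fun γ hγ => jointlyFirmlyNonexpansive_resolvent_MY hproper hconv hlsc hγ, ?_⟩
  rintro ⟨z, hz⟩ γ hγ hsum u hu
  refine exists_deltaConverges_proximal_iteration hproper hconv hlsc hγ (fun n => ?_) hz hsum
  rw [hu n]
  exact isProx_resolvent_MY hproper hconv hlsc (hγ n) (u n)
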